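/- \textbf{Theorem (Minimax lower bound via Sudakov estimate and volume ratio).} For a set $K\subseteq\mathbb{R}^p$ let $\mathcal{N}(K,\epsilon)$ be the smallest cardinality of a set $S\subseteq K$ such that every $x\in K$ satisfies $\|x-y\|_{\ell_2}<\epsilon$ for some $y\in S$, and define, for bounded $K$ (with $\log 0:=0$ if $K=\emptyset$), $$e(K)=\sup_{\epsilon>0}\epsilon\sqrt{\log\mathcal{N}(K,\epsilon)},\qquad v(K)=\sqrt{p}\left(\frac{\mathsf{vol}(K)}{\mathsf{vol}(B_2^p)}\right)^{1/p},$$ where $B_2^p$ is the closed Euclidean unit ball of $\mathbb{R}^p$ (and $v(K):=0$ if $p=0$). There is a universal constant $c_0>0$ such that the following holds for all integers $p\ge 0$, $n\ge 1$, every $\sigma>0$, every linear operator $\mathcal{X}:\mathbb{R}^p\to\mathbb{R}^n$ and every convex cone $T\subseteq\mathbb{R}^p$ (that is, $T$ is closed under addition and under multiplication by positive scalars; $T$ may be closed, so that $B_2^p\cap T$ is compact, but need not be). Consider the linear inverse model $Y=\mathcal{X}(M)+Z$ with $Z\sim N(0,\frac{\sigma^2}{n}I_n)$, where the design $\mathcal{X}$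 is fixed (conditioned upon), and let $\mathbb{E}_{\cdot|\mathcal{X}}$ denote expectation over $Z$. Then $$\inf_{\hat M}\ \sup_{M\in T}\ \mathbb{E}_{\cdot|\mathcal{X}}\,\|\hat M(Y)-M\|_{\ell_2}^2\ \ge\ \frac{c_0\sigma^2}{\psi^2}\left(\frac{e(B_2^p\cap T)}{\sqrt n}\vee\frac{v(B_2^p\cap T)}{\sqrt n}\right)^2,\qquad \psi=\sup_{v\in B_2^p\cap T}\|\mathcal{X}(v)\|_{\ell_2},$$ where the infimum is over all measurable maps $\hat M:\mathbb{R}^n\to\mathbb{R}^p$. Both sides take values in $[0,\infty]$, suprema over the empty set are $0$, and if $\psi=0$ the right-hand side is read with $a/0=\infty$ for $a>0$ and $\infty\cdot 0=0$. -/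

import Mathlib

open MeasureTheory ProbabilityTheory
open scoped ENNReal

/-- `S` is an `ε`-covering set of `K`: `S ⊆ K` and every point of `K` is at distance `< ε`
from some point of `S`. -/
def IsEpsCovering {E : Type*} [PseudoMetricSpace E] (K : Set E) (ε : ℝ) (S : Set E) : Prop :=
  S ⊆ K ∧ ∀ x ∈ K, ∃ y ∈ S, dist x y < ε

/-- The covering number `N(K, ε)`: the smallest cardinality of an `ε`-covering set of `K`. -/
noncomputable def epsCoveringNumber {E : Type*} [PseudoMetricSpace E] (K : Set E) (ε : ℝ) : ℕ∞ :=
  ⨅ (S : Set E) (_ : IsEpsCovering K ε S), S.encard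

/-- For a totally bounded set (in particular a compact set, or a bounded set of `ℝᵖ`) all
covering numbers are finite. -/
theorem epsCoveringNumber_ne_top {E : Type*} [PseudoMetricSpace E] {K : Set E}
    (hK : TotallyBounded K) {ε : ℝ} (hε : 0 < ε) : epsCoveringNumber K ε ≠ ⊤ := by
  obtain ⟨t, htK, ht, hcov⟩ := Metric.finite_approx_of_totallyBounded hK ε hε
  refine ne_top_of_le_ne_top (Set.encard_ne_top_iff.mpr ht) ?_
  refine iInf₂_le t ⟨htK, fun x hx => ?_⟩
  obtain ⟨y, hy, hxy⟩ := Set.mem_iUnion₂.mp (hcov hx)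
  exact ⟨y, hy, hxy⟩

/-- The Sudakov minoration estimate `e(K) = sup_{ε > 0} ε √(log N(K, ε))` of a totally bounded
set `K`, as an element of `[0, ∞]`. The covering numbers are finite, so that `toNat` is harmless. -/
noncomputable def sudakovEstimate {E : Type*} [PseudoMetricSpace E] (K : Set E) : ℝ≥0∞ :=
  ⨆ (ε : ℝ) (_ : 0 < ε),
    ENNReal.ofReal (ε * Real.sqrt (Real.log ((epsCoveringNumber K ε).toNat : ℝ)))

/-- The volume ratio `v(K) = √p (vol K / vol B₂ᵖ)^(1/p)` of a set `K ⊆ ℝᵖ`. -/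
noncomputable def volumeRatio {p : ℕ} (K : Set (EuclideanSpace ℝ (Fin p))) : ℝ≥0∞ :=
  ENNReal.ofReal (Real.sqrt p) *
    (volume K / volume (Metric.closedBall (0 : EuclideanSpace ℝ (Fin p)) 1)) ^ (1 / (p : ℝ))

/-- `B₂ᵖ ∩ T`. -/
def unitBallInter {p : ℕ} (T : Set (EuclideanSpace ℝ (Fin p))) :
    Set (EuclideanSpace ℝ (Fin p)) :=
  Metric.closedBall 0 1 ∩ T

/-- `ψ = sup_{v ∈ B₂ᵖ ∩ T} ‖X v‖₂`. -/
noncomputable def upperIsometryConst {p n : ℕ}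
    (X : EuclideanSpace ℝ (Fin p) →ₗ[ℝ] EuclideanSpace ℝ (Fin n))
    (T : Set (EuclideanSpace ℝ (Fin p))) : ℝ≥0∞ :=
  ⨆ v ∈ unitBallInter T, ‖X v‖ₑ

/-- The law `N(0, (σ² / n) Iₙ)` of the noise vector `Z`. -/
noncomputable def noiseLaw (n : ℕ) (σ : ℝ) : Measure (EuclideanSpace ℝ (Fin n)) :=
  multivariateGaussian 0 ((σ ^ 2 / (n : ℝ)) • (1 : Matrix (Fin n) (Fin n) ℝ))

/-- The risk `E ‖M̂(Y) - M‖₂²` of the estimator `M̂` at the parameter `M`, where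
`Y = X M + Z` and `Z ∼ N(0, (σ² / n) Iₙ)`; the design `X` is fixed. -/
noncomputable def squaredRisk {p n : ℕ}
    (X : EuclideanSpace ℝ (Fin p) →ₗ[ℝ] EuclideanSpace ℝ (Fin n)) (σ : ℝ)
    (Mhat : EuclideanSpace ℝ (Fin n) → EuclideanSpace ℝ (Fin p))
    (M : EuclideanSpace ℝ (Fin p)) : ℝ≥0∞ :=
  ∫⁻ z, ‖Mhat (X M + z) - M‖ₑ ^ 2 ∂(noiseLaw n σ)

/-- The minimax risk over the parameter set `T`: the infimum over all measurable estimators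
`M̂` of the worst-case risk over `M ∈ T`. -/
noncomputable def estimatorMinimaxRisk {p n : ℕ}
    (X : EuclideanSpace ℝ (Fin p) →ₗ[ℝ] EuclideanSpace ℝ (Fin n)) (σ : ℝ)
    (T : Set (EuclideanSpace ℝ (Fin p))) : ℝ≥0∞ :=
  ⨅ (Mhat : EuclideanSpace ℝ (Fin n) → EuclideanSpace ℝ (Fin p)) (_ : Measurable Mhat),
    ⨆ M ∈ T, squaredRisk X σ Mhat M

/-! The Sudakov part is a testing argument relative to pure noise. Let `N` be the covering number of
`B₂ᵖ ∩ T` at scale `ε`. There are `N` points of this set that are pairwise `ε`-separated, and since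
`T` is a cone they may be dilated by any `δ > 0`. For an estimator `Mhat`, the events "`Mhat` is
within `δε/2` of `δs`" are disjoint, so under pure noise one of them has probability at most `1/N`.
Passing to the law with signal `δs` costs only a square root and a factor `exp(n‖X(δs)‖²/(2σ²))`
(`noiseLaw_shift_le`). If `2nδ²ψ² ≤ σ² log N`, this factor is at most `N^(1/4)`, so the probability
of success is at most `N^(-1/4) ≤ 7/8` and the risk at `δs` is at least `(δε/2)²/8`. The largest
admissible `δ` gives `σ²ε² log N / (64nψ²)`.

The volume part follows from `v ≤ 3e` (`volumeRatio_le_three_mul_sudakovEstimate`), which compares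
the volume of the set with that of a covering by small balls. -/

/-! ### Change of measure for shifted Gaussian noise -/

section GaussianShift

theorem lintegral_pi_prod {ι : Type*} [Fintype ι] (ν : ι → Measure ℝ)
    [∀ i, IsProbabilityMeasure (ν i)] {f : ι → ℝ → ℝ≥0∞} (hf : ∀ i, Measurable (f i)) :
    ∫⁻ x, ∏ i, f i (x i) ∂(Measure.pi ν) = ∏ i, ∫⁻ t, f i t ∂(ν i) := by
  have hind : iIndepFun (fun i (x : ι → ℝ) ↦ f i (x i)) (Measure.pi ν) :=
    iIndepFun_pi (X := f) fun i ↦ (hf i).aemeasurable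
  have h := lintegral_prod_eq_prod_lintegral_of_indepFun (Finset.univ : Finset ι)
    (fun i (x : ι → ℝ) ↦ f i (x i)) hind (fun i ↦ (hf i).comp (measurable_pi_apply i))
  rw [h]
  refine Finset.prod_congr rfl fun i _ ↦ ?_
  rw [← (measurePreserving_eval ν i).lintegral_comp (hf i)]

theorem pi_withDensity_prod {ι : Type*} [Fintype ι] (ν : ι → Measure ℝ)
    [∀ i, IsProbabilityMeasure (ν i)] {f : ι → ℝ → ℝ≥0∞} (hf : ∀ i, Measurable (f i))
    [∀ i, SigmaFinite ((ν i).withDensity (f i))] :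
    Measure.pi (fun i ↦ (ν i).withDensity (f i)) =
      (Measure.pi ν).withDensity fun x ↦ ∏ i, f i (x i) := by
  refine Measure.pi_eq fun s hs ↦ ?_
  rw [withDensity_apply _ (MeasurableSet.univ_pi hs),
    ← lintegral_indicator (MeasurableSet.univ_pi hs)]
  have h : (Set.univ.pi s).indicator (fun x ↦ ∏ i, f i (x i)) =
      fun x ↦ ∏ i, (s i).indicator (f i) (x i) := by
    ext x
    by_cases hx : x ∈ Set.univ.pi s
    · rw [Set.indicator_of_mem hx]
      exact Finset.prod_congr rfl fun i _ ↦ (Set.indicator_of_mem (hx i (Set.mem_univ i)) _).symm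
    · rw [Set.indicator_of_notMem hx]
      simp only [Set.mem_univ_pi, not_forall] at hx
      obtain ⟨i, hi⟩ := hx
      exact (Finset.prod_eq_zero (Finset.mem_univ i) (Set.indicator_of_notMem hi _)).symm
  rw [h, lintegral_pi_prod ν fun i ↦ (hf i).indicator (hs i)]
  refine Finset.prod_congr rfl fun i _ ↦ ?_
  rw [withDensity_apply _ (hs i), lintegral_indicator (hs i)]

/-- The likelihood ratio of `N(m, 1)` with respect to `N(0, 1)`. -/
noncomputable def gaussianShiftDensity (m x : ℝ) : ℝ≥0∞ :=
  ENNReal.ofReal (Real.exp (m * x - m ^ 2 / 2))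

theorem measurable_gaussianShiftDensity (m : ℝ) : Measurable (gaussianShiftDensity m) := by
  unfold gaussianShiftDensity
  fun_prop

theorem gaussianReal_eq_withDensity_shift (m : ℝ) :
    gaussianReal m 1 = (gaussianReal 0 1).withDensity (gaussianShiftDensity m) := by
  rw [gaussianReal_of_var_ne_zero _ one_ne_zero, gaussianReal_of_var_ne_zero _ one_ne_zero,
    ← withDensity_mul _ (measurable_gaussianPDF 0 1) (measurable_gaussianShiftDensity m)]
  congr 1
  ext x
  simp only [Pi.mul_apply, gaussianPDF, gaussianShiftDensity]
  rw [← ENNReal.ofReal_mul (gaussianPDFReal_nonneg _ _ _)]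
  simp only [gaussianPDFReal]
  rw [mul_assoc _ (Real.exp _) (Real.exp _), ← Real.exp_add]
  congr 3
  push_cast
  ring

/-- The squared density is `exp(-m²)` times `exp(2mx)`, so this is the Gaussian moment generating
function at `2m`. -/
theorem lintegral_gaussianShiftDensity_sq (m : ℝ) :
    ∫⁻ x, gaussianShiftDensity m x ^ 2 ∂(gaussianReal 0 1) = ENNReal.ofReal (Real.exp (m ^ 2)) := by
  have h (x : ℝ) : gaussianShiftDensity m x ^ 2 =
      ENNReal.ofReal (Real.exp (- m ^ 2) * Real.exp (2 * m * x)) := by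
    rw [gaussianShiftDensity, ← ENNReal.ofReal_pow (Real.exp_nonneg _), ← Real.exp_nat_mul,
      ← Real.exp_add]
    congr 2
    push_cast
    ring
  simp_rw [h]
  rw [← ofReal_integral_eq_lintegral_ofReal
    ((integrable_exp_mul_gaussianReal (2 * m)).const_mul _)
    (Filter.Eventually.of_forall fun x ↦ by positivity), integral_const_mul]
  have := congrFun (mgf_id_gaussianReal (μ := 0) (v := 1)) (2 * m)
  simp only [mgf, id] at this
  rw [this, ← Real.exp_add]
  congr 2
  push_cast
  ring

/-- Cauchy–Schwarz applied to the likelihood ratio times the indicator of `A`: the second moment of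
the ratio factorizes over the coordinates into `exp(∑ mᵢ²)`. -/
theorem pi_gaussianReal_shift_le {ι : Type*} [Fintype ι] (m : ι → ℝ) {A : Set (ι → ℝ)}
    (hA : MeasurableSet A) :
    Measure.pi (fun _ : ι ↦ gaussianReal 0 1) ((fun x ↦ m + x) ⁻¹' A) ≤
      ENNReal.ofReal (Real.exp ((∑ i, m i ^ 2) / 2)) *
        Measure.pi (fun _ : ι ↦ gaussianReal 0 1) A ^ (1 / 2 : ℝ) := by
  set ν : Measure (ι → ℝ) := Measure.pi (fun _ : ι ↦ gaussianReal 0 1) with hν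
  have hmap : ν.map (fun x ↦ m + x) =
      ν.withDensity fun x ↦ ∏ i, gaussianShiftDensity (m i) (x i) := by
    have (i : ι) : SigmaFinite ((gaussianReal 0 1).withDensity (gaussianShiftDensity (m i))) := by
      rw [← gaussianReal_eq_withDensity_shift]; infer_instance
    rw [← pi_withDensity_prod _ fun i ↦ measurable_gaussianShiftDensity (m i)]
    simp_rw [← gaussianReal_eq_withDensity_shift]
    have h := measurePreserving_pi (fun _ : ι ↦ gaussianReal 0 1) (fun i ↦ gaussianReal (m i) 1)
      (f := fun i x ↦ m i + x) fun i ↦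
        ⟨by fun_prop, by rw [gaussianReal_map_const_add, zero_add]⟩
    exact h.map_eq
  have hL : Measurable fun x : ι → ℝ ↦ ∏ i, gaussianShiftDensity (m i) (x i) :=
    Finset.measurable_fun_prod _ fun i _ ↦
      (measurable_gaussianShiftDensity (m i)).comp (measurable_pi_apply i)
  rw [← Measure.map_apply (by fun_prop) hA, hmap, withDensity_apply _ hA,
    ← lintegral_indicator hA]
  have hind : A.indicator (fun x ↦ ∏ i, gaussianShiftDensity (m i) (x i)) =
      (fun x : ι → ℝ ↦ ∏ i, gaussianShiftDensity (m i) (x i)) * A.indicator 1 := by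
    ext x
    by_cases hx : x ∈ A <;> simp [hx]
  rw [hind]
  refine (ENNReal.lintegral_mul_le_Lp_mul_Lq ν Real.HolderConjugate.two_two hL.aemeasurable
    (measurable_one.indicator hA).aemeasurable).trans_eq ?_
  congr 2
  · simp_rw [ENNReal.rpow_two, ← Finset.prod_pow]
    rw [hν, lintegral_pi_prod _ (f := fun i t ↦ gaussianShiftDensity (m i) t ^ 2)
      fun i ↦ (measurable_gaussianShiftDensity (m i)).pow_const 2]
    simp_rw [lintegral_gaussianShiftDensity_sq]
    rw [← ENNReal.ofReal_prod_of_nonneg fun i _ ↦ (Real.exp_nonneg _), ← Real.exp_sum,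
      ENNReal.ofReal_rpow_of_nonneg (Real.exp_nonneg _) (by norm_num), ← Real.exp_mul]
    congr 2
    ring
  · have : (fun x ↦ (A.indicator (1 : (ι → ℝ) → ℝ≥0∞) x) ^ (2 : ℝ)) = A.indicator 1 := by
      ext x
      by_cases hx : x ∈ A <;> simp [hx]
    rw [this, lintegral_indicator_one hA]

-- Reduces the noise to independent standard coordinates, where the product computation applies.
open scoped MatrixOrder in
theorem noiseLaw_eq_map_pi {n : ℕ} {σ : ℝ} (hσ : 0 < σ) :
    noiseLaw n σ = (Measure.pi (fun _ : Fin n ↦ gaussianReal 0 1)).map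
      (fun x ↦ (σ / Real.sqrt n) • WithLp.toLp 2 x) := by
  have hsqrt : CFC.sqrt ((σ ^ 2 / (n : ℝ)) • (1 : Matrix (Fin n) (Fin n) ℝ)) =
      (σ / Real.sqrt n) • (1 : Matrix (Fin n) (Fin n) ℝ) := by
    have hs : 0 ≤ σ / Real.sqrt n := by positivity
    refine CFC.sqrt_unique ?_ (Matrix.PosSemidef.one.smul hs).nonneg
    rw [smul_mul_smul_comm, mul_one, div_mul_div_comm, Real.mul_self_sqrt (Nat.cast_nonneg n),
      ← pow_two]
  rw [noiseLaw, multivariateGaussian, hsqrt, ← map_pi_eq_stdGaussian,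
    Measure.map_map (by fun_prop) (by fun_prop)]
  congr 1
  ext x
  simp

instance {n : ℕ} {σ : ℝ} : IsProbabilityMeasure (noiseLaw n σ) := by
  unfold noiseLaw; infer_instance

theorem noiseLaw_shift_le {n : ℕ} (hn : 0 < n) {σ : ℝ} (hσ : 0 < σ)
    (m : EuclideanSpace ℝ (Fin n)) {A : Set (EuclideanSpace ℝ (Fin n))} (hA : MeasurableSet A) :
    noiseLaw n σ ((fun z ↦ m + z) ⁻¹' A) ≤
      ENNReal.ofReal (Real.exp (n * ‖m‖ ^ 2 / (2 * σ ^ 2))) * noiseLaw n σ A ^ (1 / 2 : ℝ) := by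
  have hn' : (0 : ℝ) < n := by exact_mod_cast hn
  set s : ℝ := σ / Real.sqrt n with hs
  have hs0 : 0 < s := by positivity
  have hmeas : Measurable fun x : Fin n → ℝ ↦ s • WithLp.toLp 2 x := by fun_prop
  rw [noiseLaw_eq_map_pi hσ, Measure.map_apply hmeas (hA.preimage (by fun_prop)),
    Measure.map_apply hmeas hA]
  convert pi_gaussianReal_shift_le (fun i ↦ s⁻¹ * m i) (hA.preimage hmeas) using 3
  · ext x
    simp only [Set.mem_preimage]
    congr! 1
    ext i
    simp
    field_simp
  · congr 1
    rw [EuclideanSpace.real_norm_sq_eq]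
    simp_rw [mul_pow]
    rw [← Finset.mul_sum, hs, inv_pow, div_pow, Real.sq_sqrt hn'.le]
    field_simp

end GaussianShift

/-! ### Coverings and separated sets -/

section Packing

/-- Greedy choice: a subset with fewer points than the covering number is not a covering, so some
point of `K` is at distance at least `ε` from all of it and can be added. -/
theorem exists_separated_finset_of_le_epsCoveringNumber {E : Type*} [PseudoMetricSpace E]
    {K : Set E} {ε : ℝ} (hε : 0 < ε) (k : ℕ) (hk : (k : ℕ∞) ≤ epsCoveringNumber K ε) :
    ∃ S : Finset E, ↑S ⊆ K ∧ S.card = k ∧ (S : Set E).Pairwise fun x y ↦ ε ≤ dist x y := by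
  classical
  induction k with
  | zero => exact ⟨∅, by simp⟩
  | succ k ih =>
    obtain ⟨S, hSK, hcard, hsep⟩ := ih ((Nat.cast_le.2 k.le_succ).trans hk)
    have hnot : ¬ IsEpsCovering K ε (S : Set E) := fun h ↦ by
      have h1 : epsCoveringNumber K ε ≤ (S : Set E).encard := iInf₂_le _ h
      rw [Set.encard_coe_eq_coe_finsetCard, hcard] at h1
      have := hk.trans h1
      norm_cast at this
      omega
    simp only [IsEpsCovering, hSK, true_and, not_forall, not_exists, not_and, not_lt] at hnot
    obtain ⟨x, hxK, hx⟩ := hnot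
    have hxS : x ∉ S := fun h ↦ by
      have := hx x h
      rw [dist_self] at this
      linarith
    refine ⟨insert x S, ?_, by rw [Finset.card_insert_of_notMem hxS, hcard], ?_⟩
    · rw [Finset.coe_insert]
      exact Set.insert_subset hxK hSK
    · rw [Finset.coe_insert]
      refine hsep.insert fun y hy _ ↦ ⟨hx y hy, ?_⟩
      rw [dist_comm]
      exact hx y hy

theorem exists_separated_finset {E : Type*} [PseudoMetricSpace E]
    {K : Set E} {ε : ℝ} (hε : 0 < ε) :
    ∃ S : Finset E, ↑S ⊆ K ∧ S.card = (epsCoveringNumber K ε).toNat ∧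
      (S : Set E).Pairwise fun x y ↦ ε ≤ dist x y :=
  exists_separated_finset_of_le_epsCoveringNumber hε _ (ENat.natCast_toNat_le_self _)

theorem exists_epsCovering_card_eq {E : Type*} [PseudoMetricSpace E] {K : Set E}
    (hK : TotallyBounded K) {ε : ℝ} (hε : 0 < ε) :
    ∃ S : Finset E, IsEpsCovering K ε (S : Set E) ∧ S.card = (epsCoveringNumber K ε).toNat := by
  have hne := epsCoveringNumber_ne_top hK hε
  have h : ∃ S, IsEpsCovering K ε S ∧ S.encard = epsCoveringNumber K ε := by
    by_contra! hcon
    -- An infimum that is finite but not attained in `ℕ∞` would exceed itself by one.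
    have hlt : ∀ S, IsEpsCovering K ε S → epsCoveringNumber K ε + 1 ≤ S.encard := fun S hS ↦
      (ENat.add_one_le_iff hne).2 (lt_of_le_of_ne (iInf₂_le S hS) (hcon S hS).symm)
    have : epsCoveringNumber K ε + 1 ≤ epsCoveringNumber K ε := le_iInf₂ hlt
    rw [ENat.add_one_le_iff hne] at this
    exact lt_irrefl _ this
  obtain ⟨S, hS, hcard⟩ := h
  have hfin : S.Finite := Set.encard_ne_top_iff.1 (hcard ▸ hne)
  refine ⟨hfin.toFinset, by rwa [hfin.coe_toFinset], ?_⟩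
  rw [← hcard, hfin.encard_eq_coe_toFinset_card, ENat.toNat_natCast]

end Packing

/-! ### Volume ratio versus Sudakov estimate -/

section Volume

theorem totallyBounded_unitBallInter {p : ℕ} (T : Set (EuclideanSpace ℝ (Fin p))) :
    TotallyBounded (unitBallInter T) :=
  (isCompact_closedBall _ _).totallyBounded.subset Set.inter_subset_left

theorem volume_le_epsCoveringNumber_mul {p : ℕ} {K : Set (EuclideanSpace ℝ (Fin p))}
    (hK : TotallyBounded K) {ε : ℝ} (hε : 0 < ε) :
    volume K ≤ (epsCoveringNumber K ε).toNat * (ENNReal.ofReal (ε ^ p) *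
      volume (Metric.closedBall (0 : EuclideanSpace ℝ (Fin p)) 1)) := by
  obtain ⟨S, ⟨-, hcov⟩, hcard⟩ := exists_epsCovering_card_eq hK hε
  have hsub : K ⊆ ⋃ y ∈ S, Metric.closedBall y ε := fun x hx ↦ by
    obtain ⟨y, hy, hxy⟩ := hcov x hx
    exact Set.mem_iUnion₂.2 ⟨y, hy, hxy.le⟩
  refine (measure_mono hsub).trans ((measure_biUnion_finset_le _ _).trans_eq ?_)
  have h (y : EuclideanSpace ℝ (Fin p)) : volume (Metric.closedBall y ε) =
      ENNReal.ofReal (ε ^ p) * volume (Metric.closedBall (0 : EuclideanSpace ℝ (Fin p)) 1) := by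
    rw [Measure.addHaar_closedBall' _ _ hε.le, finrank_euclideanSpace_fin]
  simp_rw [h]
  rw [Finset.sum_const, hcard, nsmul_eq_mul]

theorem volumeRatio_le_three_mul_sudakovEstimate {p : ℕ} (T : Set (EuclideanSpace ℝ (Fin p))) :
    volumeRatio (unitBallInter T) ≤ 3 * sudakovEstimate (unitBallInter T) := by
  rcases Nat.eq_zero_or_pos p with rfl | hp
  · simp [volumeRatio]
  have hp' : (0 : ℝ) < p := by exact_mod_cast hp
  set K := unitBallInter T with hKdef
  set B := volume (Metric.closedBall (0 : EuclideanSpace ℝ (Fin p)) 1) with hB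
  have hB0 : B ≠ 0 := (Metric.measure_closedBall_pos _ _ one_pos).ne'
  have hBtop : B ≠ ∞ := measure_closedBall_lt_top.ne
  have hKB : volume K ≤ B := measure_mono Set.inter_subset_left
  set ρ := volume K / B with hρ
  have hρtop : ρ ≠ ∞ := ENNReal.div_ne_top (ne_top_of_le_ne_top hBtop hKB) hB0
  set r : ℝ := (ρ ^ (1 / (p : ℝ))).toReal with hr
  have hρr : ρ ^ (1 / (p : ℝ)) = ENNReal.ofReal r :=
    (ENNReal.ofReal_toReal (ENNReal.rpow_ne_top_of_nonneg (by positivity) hρtop)).symm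
  have hρpow : ρ = ENNReal.ofReal (r ^ p) := by
    rw [ENNReal.ofReal_pow ENNReal.toReal_nonneg, ← hρr, ← ENNReal.rpow_natCast,
      ← ENNReal.rpow_mul, one_div_mul_cancel hp'.ne', ENNReal.rpow_one]
  have hvol : volumeRatio K = ENNReal.ofReal (Real.sqrt p * r) := by
    rw [volumeRatio, ← hB, ← hρ, hρr, ENNReal.ofReal_mul (Real.sqrt_nonneg _)]
  rcases (hr ▸ ENNReal.toReal_nonneg : 0 ≤ r).eq_or_lt with h0 | hr0
  · rw [hvol, ← h0]; simp
  -- `r` is the radius of the ball with the volume of `K`, so covering `K` by balls of radius `r /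
  -- 2` takes at least `2 ^ p` of them.
  set N := (epsCoveringNumber K (r / 2)).toNat with hN
  have hcov := volume_le_epsCoveringNumber_mul (totallyBounded_unitBallInter T) (half_pos hr0)
  have hN2 : (2 : ℝ) ^ p ≤ N := by
    have h1 : ρ ≤ ENNReal.ofReal (N * (r / 2) ^ p) := by
      rw [hρ, ENNReal.div_le_iff hB0 hBtop, ENNReal.ofReal_mul (Nat.cast_nonneg _),
        ENNReal.ofReal_natCast, mul_assoc]
      exact hcov
    rw [hρpow, ENNReal.ofReal_le_ofReal_iff (by positivity), div_pow, mul_div_assoc',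
      le_div_iff₀ (by positivity), mul_comm] at h1
    exact le_of_mul_le_mul_right h1 (by positivity)
  have hlog : p * Real.log 2 ≤ Real.log N := by
    rw [← Real.log_pow]
    exact Real.log_le_log (by positivity) hN2
  have hle : ENNReal.ofReal (r / 2 * Real.sqrt (Real.log N)) ≤ sudakovEstimate K :=
    le_iSup₂_of_le (r / 2) (half_pos hr0) le_rfl
  rw [hvol]
  refine le_trans ?_ (mul_le_mul_right hle 3)
  rw [show (3 : ℝ≥0∞) = ENNReal.ofReal 3 by simp, ← ENNReal.ofReal_mul (by norm_num)]
  refine ENNReal.ofReal_le_ofReal ?_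
  -- Uses `4 / 9 ≤ log 2`; together with the scale `r / 2` this yields the factor `3`.
  have h2 : 2 / 3 * Real.sqrt p ≤ Real.sqrt (Real.log N) := by
    refine Real.le_sqrt_of_sq_le ?_
    rw [mul_pow, Real.sq_sqrt hp'.le]
    nlinarith [Real.log_two_gt_d9]
  nlinarith

end Volume

/-! ### The testing lower bound -/

section MinimaxBound

theorem exists_mem_measureReal_le_inv_card {Ω E : Type*} [MeasurableSpace Ω] (μ : Measure Ω)
    [IsProbabilityMeasure μ] {S : Finset E} (hS : S.Nonempty) {A : E → Set Ω}
    (hA : ∀ s ∈ S, MeasurableSet (A s)) (hdisj : (S : Set E).PairwiseDisjoint A) :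
    ∃ s ∈ S, μ.real (A s) ≤ (S.card : ℝ)⁻¹ := by
  refine Finset.exists_le_of_sum_le hS ?_
  rw [← measureReal_biUnion_finset hdisj hA, Finset.sum_const, nsmul_eq_mul,
    mul_inv_cancel₀ (by exact_mod_cast hS.card_pos.ne')]
  exact measureReal_le_one

theorem exp_quarter_log_mul_inv_rpow_half_le {N : ℕ} (hN : 2 ≤ N) :
    ENNReal.ofReal (Real.exp (Real.log N / 4)) * ENNReal.ofReal (N : ℝ)⁻¹ ^ (1 / 2 : ℝ) ≤
      ENNReal.ofReal (7 / 8) := by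
  have hN0 : (0 : ℝ) < N := by positivity
  have hN2 : (2 : ℝ) ≤ N := by exact_mod_cast hN
  rw [ENNReal.ofReal_rpow_of_nonneg (by positivity) (by norm_num),
    ← ENNReal.ofReal_mul (Real.exp_nonneg _)]
  refine ENNReal.ofReal_le_ofReal ?_
  rw [Real.rpow_def_of_pos (by positivity), Real.log_inv, ← Real.exp_add,
    show Real.log N / 4 + -Real.log N * (1 / 2) = -(Real.log N / 4) by ring, Real.exp_neg]
  have h1 := Real.log_le_log two_pos hN2
  have h2 := Real.add_one_le_exp (Real.log N / 4)
  have h3 : (8 / 7 : ℝ) ≤ Real.exp (Real.log N / 4) := by linarith [Real.log_two_gt_d9]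
  exact (inv_anti₀ (by norm_num) h3).trans_eq (by norm_num)

theorem ofReal_le_estimatorMinimaxRisk {p n : ℕ} (hn : 0 < n) {σ : ℝ} (hσ : 0 < σ)
    (X : EuclideanSpace ℝ (Fin p) →ₗ[ℝ] EuclideanSpace ℝ (Fin n))
    (T : ConvexCone ℝ (EuclideanSpace ℝ (Fin p))) {S : Finset (EuclideanSpace ℝ (Fin p))}
    (hST : (S : Set (EuclideanSpace ℝ (Fin p))) ⊆ T) (hcard : 2 ≤ S.card) {ε δ : ℝ} (hδ : 0 < δ)
    (hε : 0 < ε)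
    (hsep : (S : Set (EuclideanSpace ℝ (Fin p))).Pairwise fun x y ↦ ε ≤ dist x y)
    (hX : ∀ s ∈ S, 2 * n * δ ^ 2 * ‖X s‖ ^ 2 ≤ σ ^ 2 * Real.log S.card) :
    ENNReal.ofReal (δ ^ 2 * ε ^ 2 / 32) ≤
      estimatorMinimaxRisk X σ (T : Set (EuclideanSpace ℝ (Fin p))) := by
  refine le_iInf₂ fun Mhat hM ↦ ?_
  -- The dilated points are `δ * ε`-separated, so balls of half that radius are disjoint, and so are
  -- their preimages.
  set A : EuclideanSpace ℝ (Fin p) → Set (EuclideanSpace ℝ (Fin n)) :=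
    fun s ↦ Mhat ⁻¹' Metric.ball (δ • s) (δ * ε / 2) with hAdef
  have hA (s) : MeasurableSet (A s) := hM Metric.isOpen_ball.measurableSet
  have hdisj : (S : Set (EuclideanSpace ℝ (Fin p))).PairwiseDisjoint A := fun s hs t ht hst ↦ by
    refine Disjoint.preimage _ (Metric.ball_disjoint_ball ?_)
    rw [dist_smul₀, Real.norm_of_nonneg hδ.le]
    linarith [mul_le_mul_of_nonneg_left (hsep hs ht hst) hδ.le]
  -- The reference law is that of signal zero; it serves only for comparison, so `0 ∈ T` is not
  -- needed.
  obtain ⟨s, hs, hsmall⟩ := exists_mem_measureReal_le_inv_card (noiseLaw n σ)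
    (Finset.card_pos.1 (by omega)) (fun s _ ↦ hA s) hdisj
  have hsT : δ • s ∈ (T : Set (EuclideanSpace ℝ (Fin p))) := T.smul_mem hδ (hST hs)
  refine le_iSup₂_of_le (δ • s) hsT ?_
  set B := (fun z ↦ X (δ • s) + z) ⁻¹' A s with hB
  have hBmeas : MeasurableSet B := (hA s).preimage (by fun_prop)
  have hPA : noiseLaw n σ (A s) ≤ ENNReal.ofReal (S.card : ℝ)⁻¹ := by
    rw [← ENNReal.ofReal_toReal (measure_ne_top (noiseLaw n σ) (A s))]
    exact ENNReal.ofReal_le_ofReal hsmall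
  have hPB : noiseLaw n σ B ≤ ENNReal.ofReal (7 / 8) := by
    refine (noiseLaw_shift_le hn hσ _ (hA s)).trans
      (le_trans ?_ (exp_quarter_log_mul_inv_rpow_half_le hcard))
    gcongr ENNReal.ofReal (Real.exp ?_) * ?_
    · rw [map_smul, norm_smul, Real.norm_of_nonneg hδ.le, div_le_div_iff₀ (by positivity) four_pos]
      nlinarith [hX s hs]
    · exact ENNReal.rpow_le_rpow hPA (by norm_num)
  have hPBc : ENNReal.ofReal (1 / 8) ≤ noiseLaw n σ Bᶜ := by
    rw [prob_compl_eq_one_sub hBmeas]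
    refine le_trans (le_of_eq ?_) (tsub_le_tsub_left hPB 1)
    rw [← ENNReal.ofReal_one, ← ENNReal.ofReal_sub _ (by norm_num)]
    norm_num
  have hmeas : Measurable fun z ↦ ‖Mhat (X (δ • s) + z) - δ • s‖ₑ ^ 2 := by fun_prop
  have hsub : Bᶜ ⊆ {z | ENNReal.ofReal ((δ * ε / 2) ^ 2) ≤
      ‖Mhat (X (δ • s) + z) - δ • s‖ₑ ^ 2} := fun z hz ↦ by
    have h : δ * ε / 2 ≤ dist (Mhat (X (δ • s) + z)) (δ • s) := not_lt.1 hz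
    rw [dist_eq_norm] at h
    rw [Set.mem_ofPred_eq, ← ofReal_norm, ← ENNReal.ofReal_pow (norm_nonneg _)]
    exact ENNReal.ofReal_le_ofReal (pow_le_pow_left₀ (by positivity) h 2)
  -- Markov's inequality: an error of at least `δ * ε / 2` occurs with probability at least `1 / 8`.
  calc ENNReal.ofReal (δ ^ 2 * ε ^ 2 / 32)
      = ENNReal.ofReal ((δ * ε / 2) ^ 2) * ENNReal.ofReal (1 / 8) := by
        rw [← ENNReal.ofReal_mul (by positivity)]
        congr 1
        ring
    _ ≤ ENNReal.ofReal ((δ * ε / 2) ^ 2) * noiseLaw n σ {z | ENNReal.ofReal ((δ * ε / 2) ^ 2) ≤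
          ‖Mhat (X (δ • s) + z) - δ • s‖ₑ ^ 2} := by
        gcongr
        exact hPBc.trans (measure_mono hsub)
    _ ≤ _ := mul_meas_ge_le_lintegral hmeas _

theorem upperIsometryConst_ne_top {p n : ℕ}
    (X : EuclideanSpace ℝ (Fin p) →ₗ[ℝ] EuclideanSpace ℝ (Fin n))
    (T : Set (EuclideanSpace ℝ (Fin p))) : upperIsometryConst X T ≠ ∞ := by
  have h : upperIsometryConst X T ≤ ‖LinearMap.toContinuousLinearMap X‖ₑ := iSup₂_le fun v hv ↦ by
    rw [← ofReal_norm, ← ofReal_norm]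
    refine ENNReal.ofReal_le_ofReal ?_
    have h1 : ‖v‖ ≤ 1 := mem_closedBall_zero_iff.1 hv.1
    simpa using (LinearMap.toContinuousLinearMap X).le_of_opNorm_le_of_le le_rfl h1
  exact ne_top_of_le_ne_top enorm_ne_top h

theorem norm_le_toReal_upperIsometryConst {p n : ℕ}
    (X : EuclideanSpace ℝ (Fin p) →ₗ[ℝ] EuclideanSpace ℝ (Fin n))
    (T : Set (EuclideanSpace ℝ (Fin p))) {v : EuclideanSpace ℝ (Fin p)}
    (hv : v ∈ unitBallInter T) : ‖X v‖ ≤ (upperIsometryConst X T).toReal := by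
  rw [← toReal_enorm]
  exact ENNReal.toReal_mono (upperIsometryConst_ne_top X T) (le_iSup₂_of_le v hv le_rfl)

theorem ofReal_le_estimatorMinimaxRisk_of_scale {p n : ℕ} (hn : 0 < n) {σ : ℝ} (hσ : 0 < σ)
    (X : EuclideanSpace ℝ (Fin p) →ₗ[ℝ] EuclideanSpace ℝ (Fin n))
    (T : ConvexCone ℝ (EuclideanSpace ℝ (Fin p))) {ε δ : ℝ} (hδ : 0 < δ) (hε : 0 < ε) {N : ℕ}
    (hN : (epsCoveringNumber (unitBallInter (T : Set (EuclideanSpace ℝ (Fin p)))) ε).toNat = N)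
    (hN2 : 2 ≤ N)
    (hX : 2 * n * δ ^ 2 * (upperIsometryConst X (T : Set (EuclideanSpace ℝ (Fin p)))).toReal ^ 2 ≤
      σ ^ 2 * Real.log N) :
    ENNReal.ofReal (δ ^ 2 * ε ^ 2 / 32) ≤
      estimatorMinimaxRisk X σ (T : Set (EuclideanSpace ℝ (Fin p))) := by
  obtain ⟨S, hSK, hcard, hsep⟩ := exists_separated_finset
    (K := unitBallInter (T : Set (EuclideanSpace ℝ (Fin p)))) hε
  rw [hN] at hcard
  refine ofReal_le_estimatorMinimaxRisk hn hσ X T (hSK.trans Set.inter_subset_right)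
    (hcard ▸ hN2) hδ hε hsep fun s hs ↦ ?_
  rw [hcard]
  refine le_trans ?_ hX
  have := norm_le_toReal_upperIsometryConst X _ (hSK hs)
  gcongr

/-- When `ψ = 0` the data carry no information about the separated points, so the dilation `δ` is
unconstrained and can be sent to infinity. -/
theorem estimatorMinimaxRisk_eq_top {p n : ℕ} (hn : 0 < n) {σ : ℝ} (hσ : 0 < σ)
    (X : EuclideanSpace ℝ (Fin p) →ₗ[ℝ] EuclideanSpace ℝ (Fin n))
    (T : ConvexCone ℝ (EuclideanSpace ℝ (Fin p)))
    (hψ : upperIsometryConst X (T : Set (EuclideanSpace ℝ (Fin p))) = 0)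
    (he : sudakovEstimate (unitBallInter (T : Set (EuclideanSpace ℝ (Fin p)))) ≠ 0) :
    estimatorMinimaxRisk X σ (T : Set (EuclideanSpace ℝ (Fin p))) = ∞ := by
  simp only [sudakovEstimate, ne_eq, ENNReal.iSup_eq_zero, not_forall] at he
  obtain ⟨ε, hε, h⟩ := he
  set N := (epsCoveringNumber (unitBallInter (T : Set (EuclideanSpace ℝ (Fin p)))) ε).toNat with hN
  have hN2 : 2 ≤ N := by
    by_contra! hlt
    interval_cases N <;> simp at h
  refine ENNReal.eq_top_of_forall_nnreal_le fun r ↦ ?_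
  -- Chosen so that `δ ^ 2 * ε ^ 2 / 32 = r + 1`; the added `1` keeps `δ` positive when `r = 0`.
  set δ := Real.sqrt (32 * (r + 1)) / ε with hδ
  have hr : (0 : ℝ) ≤ r := r.2
  refine le_trans ?_ (ofReal_le_estimatorMinimaxRisk_of_scale hn hσ X T (δ := δ) (by positivity) hε
    hN.symm hN2 ?_)
  · rw [← ENNReal.ofReal_coe_nnreal]
    refine ENNReal.ofReal_le_ofReal ?_
    rw [hδ, div_pow, Real.sq_sqrt (by positivity), div_mul_cancel₀ _ (by positivity)]
    linarith
  · have := Real.log_natCast_nonneg N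
    rw [hψ]
    simp only [ENNReal.toReal_zero, ne_eq, OfNat.ofNat_ne_zero, not_false_eq_true, zero_pow,
      mul_zero]
    positivity

theorem mul_sudakovEstimate_sq_le_estimatorMinimaxRisk {p n : ℕ} (hn : 0 < n) {σ : ℝ} (hσ : 0 < σ)
    (X : EuclideanSpace ℝ (Fin p) →ₗ[ℝ] EuclideanSpace ℝ (Fin n))
    (T : ConvexCone ℝ (EuclideanSpace ℝ (Fin p))) {ψ : ℝ} (hψ0 : 0 < ψ)
    (hψ : upperIsometryConst X (T : Set (EuclideanSpace ℝ (Fin p))) = ENNReal.ofReal ψ) :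
    ENNReal.ofReal (σ ^ 2 / (64 * n * ψ ^ 2)) *
        sudakovEstimate (unitBallInter (T : Set (EuclideanSpace ℝ (Fin p)))) ^ 2 ≤
      estimatorMinimaxRisk X σ (T : Set (EuclideanSpace ℝ (Fin p))) := by
  have hn' : (0 : ℝ) < n := by exact_mod_cast hn
  set R := estimatorMinimaxRisk X σ (T : Set (EuclideanSpace ℝ (Fin p)))
  set k := ENNReal.ofReal (σ ^ 2 / (64 * n * ψ ^ 2)) with hk
  have hk0 : k ≠ 0 := by
    rw [hk, ne_eq, ENNReal.ofReal_eq_zero, not_le]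
    positivity
  have hktop : k ≠ ∞ := ENNReal.ofReal_ne_top
  -- Isolating `a` turns the claim into an upper bound on a supremum, which can be checked for each
  -- `ε` separately.
  have hiff (a : ℝ≥0∞) : k * a ^ 2 ≤ R ↔ a ≤ (R / k) ^ (1 / 2 : ℝ) := by
    rw [one_div, ENNReal.le_rpow_inv_iff two_pos, ENNReal.rpow_two,
      ENNReal.le_div_iff_mul_le (Or.inl hk0) (Or.inl hktop), mul_comm]
  rw [hiff]
  refine iSup₂_le fun ε hε ↦ ?_
  rw [← hiff]
  set N := (epsCoveringNumber (unitBallInter (T : Set (EuclideanSpace ℝ (Fin p)))) ε).toNat with hN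
  rcases lt_or_ge N 2 with hlt | hN2
  · interval_cases N <;> simp
  have hlog : 0 < Real.log N := Real.log_pos (by exact_mod_cast hN2)
  -- The largest dilation allowed by the change-of-measure constraint, which becomes an equality.
  set δ := Real.sqrt (σ ^ 2 * Real.log N / (2 * n * ψ ^ 2)) with hδ
  have hδ2 : δ ^ 2 = σ ^ 2 * Real.log N / (2 * n * ψ ^ 2) := Real.sq_sqrt (by positivity)
  refine le_trans (le_of_eq ?_) (ofReal_le_estimatorMinimaxRisk_of_scale hn hσ X T (δ := δ)
    (by positivity) hε hN.symm hN2 ?_)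
  · rw [hk, ← ENNReal.ofReal_pow (by positivity), ← ENNReal.ofReal_mul (by positivity), hδ2,
      mul_pow, Real.sq_sqrt hlog.le]
    congr 1
    field_simp
    norm_num
  · rw [hψ, ENNReal.toReal_ofReal hψ0.le, hδ2]
    refine le_of_eq ?_
    field_simp

end MinimaxBound

theorem mainTheorem3 :
    ∃ c₀ : ℝ, 0 < c₀ ∧
      ∀ (p n : ℕ) (_ : 0 < n) (σ : ℝ) (_ : 0 < σ)
        (X : EuclideanSpace ℝ (Fin p) →ₗ[ℝ] EuclideanSpace ℝ (Fin n))
        (T : ConvexCone ℝ (EuclideanSpace ℝ (Fin p))),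
        ENNReal.ofReal (c₀ * σ ^ 2) / upperIsometryConst X (T : Set (EuclideanSpace ℝ (Fin p))) ^ 2 *
            max
              (sudakovEstimate (unitBallInter (T : Set (EuclideanSpace ℝ (Fin p)))) /
                ENNReal.ofReal (Real.sqrt n))
              (volumeRatio (unitBallInter (T : Set (EuclideanSpace ℝ (Fin p)))) /
                ENNReal.ofReal (Real.sqrt n)) ^ 2
          ≤ estimatorMinimaxRisk X σ (T : Set (EuclideanSpace ℝ (Fin p))) := by
  -- `576 = 64 * 3 ^ 2`: the `64` of the Sudakov bound and the squared factor of `v ≤ 3e`.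
  refine ⟨1 / 576, by norm_num, fun p n hn σ hσ X T ↦ ?_⟩
  have hn' : (0 : ℝ) < n := by exact_mod_cast hn
  set K := unitBallInter (T : Set (EuclideanSpace ℝ (Fin p))) with hK
  have hmax : max (sudakovEstimate K / ENNReal.ofReal (Real.sqrt n))
      (volumeRatio K / ENNReal.ofReal (Real.sqrt n)) ≤
        3 * sudakovEstimate K / ENNReal.ofReal (Real.sqrt n) :=
    max_le (ENNReal.div_le_div_right (le_mul_of_one_le_left' (by norm_num)) _)
      (ENNReal.div_le_div_right (volumeRatio_le_three_mul_sudakovEstimate _) _)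
  refine (mul_le_mul_right (pow_le_pow_left' hmax 2) _).trans ?_
  have hψtop := upperIsometryConst_ne_top X (T : Set (EuclideanSpace ℝ (Fin p)))
  rcases eq_or_ne (upperIsometryConst X (T : Set (EuclideanSpace ℝ (Fin p)))) 0 with hψ | hψ
  -- With `ψ = 0` the left side is `∞ * 0 = 0` if the estimate vanishes; otherwise the risk itself
  -- is infinite.
  · rcases eq_or_ne (sudakovEstimate K) 0 with he | he
    · simp [he]
    · rw [estimatorMinimaxRisk_eq_top hn hσ X T hψ he]
      exact le_top
  · set ψ := (upperIsometryConst X (T : Set (EuclideanSpace ℝ (Fin p)))).toReal with hψr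
    have hψ0 : 0 < ψ := ENNReal.toReal_pos hψ hψtop
    have hψe : upperIsometryConst X (T : Set (EuclideanSpace ℝ (Fin p))) = ENNReal.ofReal ψ :=
      (ENNReal.ofReal_toReal hψtop).symm
    refine le_trans (le_of_eq ?_)
      (mul_sudakovEstimate_sq_le_estimatorMinimaxRisk hn hσ X T hψ0 hψe)
    have h9 : (3 : ℝ≥0∞) * sudakovEstimate K / ENNReal.ofReal (Real.sqrt n) =
        ENNReal.ofReal (3 / Real.sqrt n) * sudakovEstimate K := by
      rw [ENNReal.ofReal_div_of_pos (by positivity), ENNReal.mul_div_right_comm]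
      simp
    rw [h9, hψe, mul_pow, ← mul_assoc, ← ENNReal.ofReal_pow hψ0.le, ← ENNReal.ofReal_pow
      (by positivity), ← ENNReal.ofReal_div_of_pos (by positivity),
      ← ENNReal.ofReal_mul (by positivity), div_pow 3, Real.sq_sqrt hn'.le]
    congr 2
    field_simp
    norm_num
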